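/- All graphs are simple and plane, with outer cycle written $C\colon v_1v_2\cdots v_kv_1$ ($k\ge 3$); the vertices not on $C$ are called inner vertices. A wheel is a graph consisting of such a cycle $C$ and one inner vertex joined to all vertices of $C$. Multi-wheels are the graphs obtained as follows. Every wheel is a multi-wheel. If $G$ is a multi-wheel with outer cycle $v_1v_2\cdots v_kv_1$ and $v_i u v_{i+1}$ ($2\le i\le k-1$) is a facial triangle of $G$ that does not contain $v_1$, where the edges $uv_i,uv_{i+1}$ lie in the interior of $C$, then the following graph is a multi-wheel: replace the edge $v_iv_{i+1}$ of the outer cycle by a path $v_iw_1\cdots w_jv_{i+1}$ with $j\ge 0$ new vertices $w_1,\dots,w_j$, and add a new inner vertex $w$ joined to $u,v_i,w_1,\dots,w_j,v_{i+1}$; the outer cycle of the new graph is $v_1\cdots v_iw_1\cdots w_jv_{i+1}\cdots v_kv_1$, with the same first vertex $v_1$. A separating triangle is a triangle whose three vertices leave a disconnected graph when they are deleted. Let $G$ be a multi-wheel with outer cycle $C\colon v_1v_2\cdots v_kv_1$. Assume that $G$ has no separating triangle, that $G$ has at least two inner vertices, and that all inner vertices are joined to $v_2$. Then, for every orientation of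 $G$ and every $\phi\colon E(G)\to\mathbb Z_5$, the graph $G$ is $(\mathbb Z_5,3)$-extendable with respect to $\phi$ and the vertices $v_1,v_2,v_k$. That is: let colors $c(v_k),c(v_1),c(v_2)\in\mathbb Z_5$ be given that satisfy the coloring condition below on the two edges $v_kv_1$ and $v_1v_2$, and let $F_v\subseteq\mathbb Z_5$ with $|F_v|\le 2$ be given for each $v\in V(C)\setminus\{v_1,v_2,v_k\}$. Then $c$ extends to a map $c\colon V(G)\to\mathbb Z_5$ such that $c(y)-c(x)\ne\phi(xy)$ for every edge $xy$ directed from $x$ towards $y$, and $c(v)\notin F_v$ for every $v\in V(C)\setminus\{v_1,v_2,v_k\}$. -/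

import Mathlib

/-- A finite plane near-triangulation together with its outer cycle, recorded combinatorially:
its vertex set, its edges (a simple graph on the ambient label type `V`), its outer cycle
`v₁ v₂ … v_k v₁` as the list `[v₁, v₂, …, v_k]`, and the vertex sets of its bounded facial
triangles.  This is only a record of data; the graphs considered below are those built from
wheels by the operations below, which determine all four components. -/
structure PlaneGraph (V : Type*) where
  /-- the vertices -/
  verts : Set V
  /-- the edges -/
  graph : SimpleGraph V
  /-- the outer cycle, starting at the major vertex `v₁` -/
  outer : List V
  /-- the vertex sets of the bounded faces -/
  faces : Set (Set V)

/-- `x, y` are consecutive entries (in this order) of the list `L`. -/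
def Consecutive {V : Type*} (L : List V) (x y : V) : Prop := [x, y] <:+: L

/-- The graph formed by the path that runs through the entries of a list in order. -/
def pathOf {V : Type*} (L : List V) : SimpleGraph V :=
  SimpleGraph.fromRel (Consecutive L)

/-- The star that joins `w` to all elements of `S`. -/
def starOf {V : Type*} (w : V) (S : Set V) : SimpleGraph V :=
  SimpleGraph.fromRel fun x y => x = w ∧ y ∈ S

/-- The triangles spanned by `w` and two consecutive entries of `L`. -/
def fanFaces {V : Type*} (w : V) (L : List V) : Set (Set V) :=
  {T | ∃ x y, Consecutive L x y ∧ T = {w, x, y}}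

namespace PlaneGraph

/-- The wheel with outer cycle `C` and hub `h`: the hub is joined to all vertices of the cycle.
(`C ++ C.take 1` is the closed walk `v₁ v₂ … v_k v₁`.) -/
def wheel {V : Type*} (h : V) (C : List V) : PlaneGraph V where
  verts := {x | x = h ∨ x ∈ C}
  graph := pathOf (C ++ C.take 1) ⊔ starOf h {x | x ∈ C}
  outer := C
  faces := fanFaces h (C ++ C.take 1)

/-- Inserting a wheel into the triangle `a u b`, where `a b` is an edge of the outer cycle
`l ++ [a, b] ++ r`: the edge `a b` is replaced by the path `a w₁ … w_j b` with `p = [w₁, …, w_j]`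
(for `j = 0` this is the edge `a b` itself), and a new vertex `w` is joined to `u` and to all
vertices of this path. -/
def insertWheel {V : Type*} (G : PlaneGraph V) (l r : List V) (a b u w : V) (p : List V) :
    PlaneGraph V where
  verts := G.verts ∪ {x | x = w ∨ x ∈ p}
  graph := G.graph.deleteEdges {s(a, b)} ⊔ pathOf (a :: p ++ [b])
    ⊔ starOf w {x | x = u ∨ x ∈ a :: p ++ [b]}
  outer := l ++ (a :: p ++ [b]) ++ r
  faces := (G.faces \ {{a, b, u}}) ∪ {{w, u, a}, {w, u, b}} ∪ fanFaces w (a :: p ++ [b])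

/-- Multi-wheels: all wheels, and all graphs obtained from a multi-wheel by inserting a wheel into
a facial triangle `a u b` that avoids the major vertex `v₁`, where `a b` is an edge of the outer
cycle and the edges `u a`, `u b` lie in its interior.  The condition `l ≠ []` says that `a` (and
hence `b`) is not `v₁`; as multi-wheels have no chords, `u` is an inner vertex. -/
inductive IsMultiWheel {V : Type*} : PlaneGraph V → Prop
  | wheel (h : V) (C : List V) (hlen : 3 ≤ C.length) (hnodup : (h :: C).Nodup) :
      IsMultiWheel (PlaneGraph.wheel h C)
  | insert (G : PlaneGraph V) (l r : List V) (a b u w : V) (p : List V)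
      (hG : IsMultiWheel G)
      (houter : G.outer = l ++ [a, b] ++ r) (hl : l ≠ [])
      (hu : u ∈ G.verts) (hu' : u ∉ G.outer)
      (hface : {a, b, u} ∈ G.faces)
      (hnew : ∀ x ∈ w :: p, x ∉ G.verts) (hnodup : (w :: p).Nodup) :
      IsMultiWheel (G.insertWheel l r a b u w p)

/-- The inner vertices: the vertices that are not on the outer cycle. -/
def inner {V : Type*} (G : PlaneGraph V) : Set V := {x ∈ G.verts | x ∉ G.outer}

/-- A separating triangle: three pairwise adjacent vertices whose deletion leaves a disconnected
graph. -/
def HasSeparatingTriangle {V : Type*} (G : PlaneGraph V) : Prop :=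
  ∃ x y z : V, G.graph.Adj x y ∧ G.graph.Adj y z ∧ G.graph.Adj x z ∧
    ¬ (G.graph.induce (G.verts \ {x, y, z})).Preconnected

end PlaneGraph

/-- An orientation of a simple graph: each edge is directed towards exactly one of its ends;
`dir x y` means that `xy` is an edge directed from `x` towards `y`. -/
structure EdgeOrientation {V : Type*} (G : SimpleGraph V) where
  /-- the direction relation -/
  dir : V → V → Prop
  adj_of_dir : ∀ x y, dir x y → G.Adj x y
  dir_or_dir : ∀ x y, G.Adj x y → dir x y ∨ dir y x
  asymm : ∀ x y, dir x y → ¬ dir y x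

/-- `c` is a `(ℤ₅, φ)`-coloring: `c y - c x ≠ φ(xy)` for each edge `xy` directed towards `y`.
Only the values of `φ` on edges matter. -/
def IsGroupColoring {V : Type*} {G : SimpleGraph V} (D : EdgeOrientation G)
    (φ : Sym2 V → ZMod 5) (c : V → ZMod 5) : Prop :=
  ∀ x y, D.dir x y → c y - c x ≠ φ s(x, y)

open Classical in
/-- The color at the neighbor `u` of `v` that is not allowed if `v` has color `α`. -/
noncomputable def tau {V : Type*} {G : SimpleGraph V} (D : EdgeOrientation G)
    (φ : Sym2 V → ZMod 5) (v : V) (α : ZMod 5) (u : V) : ZMod 5 :=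
  if D.dir v u then α + φ s(v, u) else α - φ s(v, u)

/-- `(ℤ₅, 3)`-extendability with respect to `φ` and the vertices `v₁, v₂, v_k`.  Here `c₀` supplies
the precolors of `v_k, v₁, v₂` (its other values are irrelevant), and `F` is the assignment of
forbidden colors. -/
def PlaneGraph.IsThreeExtendable {V : Type*} (G : PlaneGraph V) (D : EdgeOrientation G.graph)
    (φ : Sym2 V → ZMod 5) (v₁ v₂ vk : V) : Prop :=
  ∀ (c₀ : V → ZMod 5) (F : V → Finset (ZMod 5)),
    c₀ vk ≠ tau D φ v₁ (c₀ v₁) vk →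
    c₀ v₂ ≠ tau D φ v₁ (c₀ v₁) v₂ →
    (∀ x ∈ G.outer, x ≠ v₁ → x ≠ v₂ → x ≠ vk → (F x).card ≤ 2) →
    (∀ x, ¬ (x ∈ G.outer ∧ x ≠ v₁ ∧ x ≠ v₂ ∧ x ≠ vk) → F x = ∅) →
    ∃ c : V → ZMod 5, c v₁ = c₀ v₁ ∧ c v₂ = c₀ v₂ ∧ c vk = c₀ vk ∧
      IsGroupColoring D φ c ∧
      ∀ x ∈ G.outer, x ≠ v₁ → x ≠ v₂ → x ≠ vk → c x ∉ F x

/-!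
We work with list colorings in the sense of correspondence (DP) coloring: every pair `x, y` carries
a permutation `σ x y` of the colors, and the color `α` at `x` excludes the color `σ x y α` at `y`.
Inner vertices have lists of size five, outer ones lists of size three.

If every inner vertex is joined to `v₂`, then every wheel is inserted into the triangle formed by
`v₂`, the next vertex `b` of the outer cycle and the hub of the previous wheel.  Hence `G` minus the
edge `v₂b` arises from the path `v_k v₁ v₂` by repeatedly adding a fan whose hub has only three old
neighbors.  Such a hub can be colored in two ways, and the outer path of the fan can then be colored
greedily.  So `G - v₂b` has, at every stage, two list colorings that differ at the newest hub.

Restoring the edge `v₂d` at the last stage costs the end `d` of the last fan one color, so its list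
only has size two.  The greedy coloring of a path next to a hub of color `γ` then fails for at most
one color of its first vertex, and only if `γ` excludes a color from the list of `d`, which happens
for at most two values of `γ`.  The two colorings of the previous stage leave at least three values
of `γ` to choose from.  (If no outer vertex `d` is added, the last triangle separates its hub from
the rest.)
-/

/-- A correspondence (DP) assignment with colors in `A`: `σ x y α` is the color at `y` that is
excluded if `x` has color `α`.  The group colorings of a graph are the case in which the
permutations are translations.  A permutation is recorded for all pairs of vertices, adjacent or
not. -/
structure Correspondence (V A : Type*) where
  /-- the permutation from the colors at the first vertex to those at the second -/
  perm : V → V → Equiv.Perm A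
  perm_symm : ∀ x y, (perm x y).symm = perm y x

namespace Correspondence

variable {V A : Type*}

instance : CoeFun (Correspondence V A) fun _ => V → V → Equiv.Perm A := ⟨perm⟩

theorem ne_apply_comm (σ : Correspondence V A) {x y : V} {α β : A} :
    β ≠ σ x y α ↔ α ≠ σ y x β := by
  rw [← σ.perm_symm x y, ne_eq, ne_eq, Equiv.eq_symm_apply, eq_comm]

/-- `c` is a coloring of the graph `H` in the sense of the correspondence `σ`. -/
def IsColoring (σ : Correspondence V A) (H : SimpleGraph V) (c : V → A) : Prop :=
  ∀ ⦃x y⦄, H.Adj x y → c y ≠ σ x y (c x)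

/-- `c` is a coloring of the graph `H` with vertex set `S` from the lists `L`. -/
structure IsListColoring (σ : Correspondence V A) (H : SimpleGraph V) (S : Set V)
    (L : V → Finset A) (c : V → A) : Prop where
  isColoring : σ.IsColoring H c
  mem_list : ∀ x ∈ S, c x ∈ L x

variable {σ : Correspondence V A} {H K : SimpleGraph V} {S : Set V} {L : V → Finset A}
  {c c' : V → A}

theorem IsColoring.mono (h : σ.IsColoring K c) (hHK : H ≤ K) : σ.IsColoring H c :=
  fun _ _ hxy => h (hHK hxy)

theorem IsColoring.sup (hH : σ.IsColoring H c) (hK : σ.IsColoring K c) :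
    σ.IsColoring (H ⊔ K) c :=
  fun _ _ hxy => hxy.elim (fun h => hH h) fun h => hK h

theorem IsColoring.congr (h : σ.IsColoring H c) (hcc' : ∀ x ∈ H.support, c' x = c x) :
    σ.IsColoring H c' := fun x y hxy => by
  rw [hcc' x ⟨y, hxy⟩, hcc' y ⟨x, hxy.symm⟩]
  exact h hxy

theorem isColoring_fromRel {r : V → V → Prop} (h : ∀ x y, r x y → c y ≠ σ x y (c x)) :
    σ.IsColoring (SimpleGraph.fromRel r) c := by
  rintro x y ⟨-, hxy | hyx⟩
  · exact h x y hxy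
  · exact σ.ne_apply_comm.1 (h y x hyx)

theorem isColoring_pathOf {l : List V} (h : l.IsChain fun x y => c y ≠ σ x y (c x)) :
    σ.IsColoring (pathOf l) c :=
  isColoring_fromRel fun x y hxy => by simpa using h.infix hxy

theorem isColoring_starOf {w : V} {T : Set V} (h : ∀ x ∈ T, c x ≠ σ w x (c w)) :
    σ.IsColoring (starOf w T) c :=
  isColoring_fromRel fun _ y ⟨hx, hy⟩ => hx ▸ h y hy

theorem IsColoring.of_deleteEdges {a b : V} (h : σ.IsColoring (H.deleteEdges {s(a, b)}) c)
    (hab : c b ≠ σ a b (c a)) : σ.IsColoring H c := by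
  intro x y hxy
  by_cases hs : s(x, y) = s(a, b)
  · rcases Sym2.eq_iff.1 hs with ⟨rfl, rfl⟩ | ⟨rfl, rfl⟩
    · exact hab
    · exact σ.ne_apply_comm.1 hab
  · exact h (SimpleGraph.deleteEdges_adj.2 ⟨hxy, hs⟩)

theorem IsListColoring.mono {S' : Set V} (h : σ.IsListColoring K S' L c) (hHK : H ≤ K)
    (hS : S ⊆ S') : σ.IsListColoring H S L c :=
  ⟨h.isColoring.mono hHK, fun x hx => h.mem_list x (hS hx)⟩

theorem IsListColoring.mono_list {L' : V → Finset A} (h : σ.IsListColoring H S L c)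
    (hL : ∀ x ∈ S, L x ⊆ L' x) : σ.IsListColoring H S L' c :=
  ⟨h.isColoring, fun x hx => hL x hx (h.mem_list x hx)⟩

/-- `H` has two colorings from the lists `L` that differ at the vertex `w`. -/
def HasTwoListColorings (σ : Correspondence V A) (H : SimpleGraph V) (S : Set V)
    (L : V → Finset A) (w : V) : Prop :=
  ∃ c c', σ.IsListColoring H S L c ∧ σ.IsListColoring H S L c' ∧ c w ≠ c' w

theorem HasTwoListColorings.mono {S' : Set V} {w : V} (h : σ.HasTwoListColorings K S' L w)
    (hHK : H ≤ K) (hS : S ⊆ S') : σ.HasTwoListColorings H S L w :=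
  let ⟨c, c', hc, hc', hne⟩ := h
  ⟨c, c', hc.mono hHK hS, hc'.mono hHK hS, hne⟩

theorem HasTwoListColorings.mono_list {L' : V → Finset A} {w : V}
    (h : σ.HasTwoListColorings H S L w) (hL : ∀ x ∈ S, L x ⊆ L' x) :
    σ.HasTwoListColorings H S L' w :=
  let ⟨c, c', hc, hc', hne⟩ := h
  ⟨c, c', hc.mono_list hL, hc'.mono_list hL, hne⟩

/-- The path through `b` and the entries of `q` can be colored from the lists `L` next to a hub `w`
of color `γ`, starting with the color `β` at `b`. -/
def FanColorable (σ : Correspondence V A) (L : V → Finset A) (w : V) (γ : A) :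
    V → A → List V → Prop
  | _, _, [] => True
  | b, β, x :: q =>
    ∃ α ∈ L x, α ≠ σ w x γ ∧ α ≠ σ b x β ∧ FanColorable σ L w γ x α q

section Fan

variable {w b z : V} {γ β β' : A} {q : List V}

theorem exists_mem_ne_of_three_le_card {s : Finset A} (hs : 3 ≤ s.card) (x y : A) :
    ∃ α ∈ s, α ≠ x ∧ α ≠ y := by
  classical
  have hlt : ({x, y} : Finset A).card < s.card := Finset.card_le_two.trans_lt hs
  simpa using Finset.exists_mem_notMem_of_card_lt_card hlt

theorem fanColorable_of_three_le_card (hq : ∀ x ∈ q, 3 ≤ (L x).card) (b : V) (β : A) :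
    σ.FanColorable L w γ b β q := by
  induction q generalizing b β with
  | nil => trivial
  | cons x q ih =>
    rw [List.forall_mem_cons] at hq
    obtain ⟨α, hα, hw, hb⟩ := exists_mem_ne_of_three_le_card hq.1 (σ w x γ) (σ b x β)
    exact ⟨α, hα, hw, hb, ih hq.2 x α⟩

theorem apply_mem_of_not_fanColorable (hq : ∀ x ∈ q, 3 ≤ (L x).card) (hz : 2 ≤ (L z).card)
    (h : ¬ σ.FanColorable L w γ b β (q ++ [z])) : σ w z γ ∈ L z := by
  induction q generalizing b β with
  | nil =>
    by_contra hγ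
    obtain ⟨α, hα, hb⟩ := Finset.exists_mem_ne hz (σ b z β)
    exact h ⟨α, hα, ne_of_mem_of_not_mem hα hγ, hb, trivial⟩
  | cons x q ih =>
    rw [List.forall_mem_cons] at hq
    obtain ⟨α, hα, hw, hb⟩ := exists_mem_ne_of_three_le_card hq.1 (σ w x γ) (σ b x β)
    exact ih hq.2 fun hfan => h ⟨α, hα, hw, hb, hfan⟩

theorem eq_of_not_fanColorable (hq : ∀ x ∈ q, 3 ≤ (L x).card) (hz : 2 ≤ (L z).card)
    (h : ¬ σ.FanColorable L w γ b β (q ++ [z])) (h' : ¬ σ.FanColorable L w γ b β' (q ++ [z])) :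
    β = β' := by
  induction q generalizing b β β' with
  | nil =>
    by_contra hne
    obtain ⟨α, hα, hw⟩ := Finset.exists_mem_ne hz (σ w z γ)
    by_cases hb : α = σ b z β
    · exact h' ⟨α, hα, hw, fun hb' => hne ((σ b z).injective (hb.symm.trans hb')), trivial⟩
    · exact h ⟨α, hα, hw, hb, trivial⟩
  | cons x q ih =>
    rw [List.forall_mem_cons] at hq
    by_contra hne
    have not_fanColorable : ∀ α ∈ L x, α ≠ σ w x γ → ¬ σ.FanColorable L w γ x α (q ++ [z]) := by
      intro α hα hw hfan
      by_cases hb : α = σ b x β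
      · exact h' ⟨α, hα, hw, fun hb' => hne ((σ b x).injective (hb.symm.trans hb')), hfan⟩
      · exact h ⟨α, hα, hw, hb, hfan⟩
    obtain ⟨α, hα, hw, -⟩ := exists_mem_ne_of_three_le_card hq.1 (σ w x γ) (σ w x γ)
    obtain ⟨α', hα', hw', hαα'⟩ := exists_mem_ne_of_three_le_card hq.1 (σ w x γ) α
    exact hαα' (ih hq.2 (not_fanColorable α' hα' hw') (not_fanColorable α hα hw))

theorem card_lt_three_of_not_fanColorable (hq : ∀ x ∈ q, 3 ≤ (L x).card) (hz : 2 ≤ (L z).card)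
    {E : Finset A} (hE : ∀ γ ∈ E, ∃ β, ¬ σ.FanColorable L w γ b β (q ++ [z])) : E.card < 3 := by
  by_contra! hE3
  obtain ⟨γ, hγ⟩ := Finset.card_pos.1 (by lia : 0 < E.card)
  obtain ⟨β, hβ⟩ := hE γ hγ
  have hsub : E.map (σ w z).toEmbedding ⊆ L z := by
    intro α hα
    obtain ⟨γ, hγ, rfl⟩ := Finset.mem_map.1 hα
    obtain ⟨β, hβ⟩ := hE γ hγ
    exact apply_mem_of_not_fanColorable hq hz hβ
  have hz3 : 3 ≤ (L z).card := hE3.trans (by simpa using Finset.card_le_card hsub)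
  refine hβ (fanColorable_of_three_le_card (fun v hv => ?_) _ _)
  rcases List.mem_append.1 hv with hv | hv
  · exact hq v hv
  · exact List.mem_singleton.1 hv ▸ hz3

theorem exists_fanColorable [DecidableEq A] (hq : ∀ x ∈ q, 3 ≤ (L x).card)
    (hz : 2 ≤ (L z).card) (hw : 5 ≤ (L w).card) {y y' : A} (hy : y ≠ y') (x : A) (ρ : A → A) :
    (∃ γ ∈ L w \ {x, y, ρ β}, σ.FanColorable L w γ b β (q ++ [z])) ∨
      ∃ γ ∈ L w \ {x, y', ρ β'}, σ.FanColorable L w γ b β' (q ++ [z]) := by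
  by_contra! ⟨h, h'⟩
  have lt_three {E : Finset A} (hE : ∀ γ ∈ E, ∃ β, ¬ σ.FanColorable L w γ b β (q ++ [z])) :
      E.card < 3 := card_lt_three_of_not_fanColorable hq hz hE
  by_cases hβ : β = β'
  · subst hβ
    have hE : 3 ≤ (L w \ {x, ρ β}).card := by
      have := Finset.le_card_sdiff {x, ρ β} (L w)
      have := Finset.card_le_two (a := x) (b := ρ β)
      lia
    refine (lt_three fun γ hγ => ⟨β, ?_⟩).not_ge hE
    by_cases hγy : γ = y
    · exact h' γ (by grind)
    · exact h γ (by grind)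
  · have two_le (y β : A) : 2 ≤ (L w \ {x, y, ρ β}).card := by
      have := Finset.le_card_sdiff {x, y, ρ β} (L w)
      have := Finset.card_le_three (a := x) (b := y) (c := ρ β)
      lia
    have hdisj : Disjoint (L w \ {x, y, ρ β}) (L w \ {x, y', ρ β'}) :=
      Finset.disjoint_left.2 fun γ hγ hγ' =>
        hβ (eq_of_not_fanColorable hq hz (h γ hγ) (h' γ hγ'))
    have hcard := Finset.card_union_of_disjoint hdisj
    have := lt_three (E := (L w \ {x, y, ρ β}) ∪ (L w \ {x, y', ρ β'})) fun γ hγ =>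
      (Finset.mem_union.1 hγ).elim (fun hγ => ⟨β, h γ hγ⟩) fun hγ => ⟨β', h' γ hγ⟩
    have := two_le y β
    have := two_le y' β'
    lia

theorem FanColorable.exists_coloring (h : σ.FanColorable L w γ b (c b) q)
    (hnodup : (b :: q).Nodup) :
    ∃ c' : V → A, (∀ x, x ∉ q → c' x = c x) ∧ (∀ x ∈ q, c' x ∈ L x ∧ c' x ≠ σ w x γ) ∧
      (b :: q).IsChain fun x y => c' y ≠ σ x y (c' x) := by
  classical
  induction q generalizing b c with
  | nil => exact ⟨c, by simp⟩
  | cons x q ih =>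
    obtain ⟨α, hα, hαw, hαb, hfan⟩ := h
    obtain ⟨hb, hxq⟩ := List.nodup_cons.1 hnodup
    rw [List.mem_cons, not_or] at hb
    obtain ⟨c', heq, hmem, hchain⟩ :=
      ih (c := Function.update c x α) (by simpa using hfan) hxq
    have hcx : c' x = α := by simp [heq x (List.nodup_cons.1 hxq).1]
    have hcb : c' b = c b := by simp [heq b hb.2, hb.1]
    refine ⟨c', fun y hy => ?_, List.forall_mem_cons.2 ⟨by simp [hcx, hα, hαw], hmem⟩,
      List.isChain_cons_cons.2 ⟨by rwa [hcx, hcb], hchain⟩⟩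
    rw [List.mem_cons, not_or] at hy
    simp [heq y hy.2, hy.1]

end Fan

end Correspondence

/-- The graph obtained from `H` by adding a fan: the path that runs from the old vertex `b` through
the entries of `q`, and the hub `w`, joined to this path and to the old vertices `x` and `y`. -/
def attachFan {V : Type*} (H : SimpleGraph V) (x y b w : V) (q : List V) : SimpleGraph V :=
  H ⊔ pathOf (b :: q) ⊔ starOf w {z | z = x ∨ z = y ∨ z ∈ b :: q}

namespace Correspondence

variable {V A : Type*} {σ : Correspondence V A} {H : SimpleGraph V} {S : Set V} {L : V → Finset A}
  {c : V → A} {x y b w : V} {q : List V}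

theorem IsListColoring.exists_attachFan [DecidableEq A] (hc : σ.IsListColoring H S L c)
    (hH : H.support ⊆ S) (hx : x ∈ S) (hy : y ∈ S) (hb : b ∈ S) (hnew : ∀ z ∈ w :: q, z ∉ S)
    (hnodup : (w :: q).Nodup) {γ : A}
    (hγ : γ ∈ L w \ {σ x w (c x), σ y w (c y), σ b w (c b)})
    (hfan : σ.FanColorable L w γ b (c b) q) :
    ∃ c', σ.IsListColoring (attachFan H x y b w q) (S ∪ {z | z ∈ w :: q}) L c' ∧ c' w = γ := by
  classical
  rw [List.forall_mem_cons] at hnew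
  rw [List.nodup_cons] at hnodup
  have hq : ∀ z ∈ S, z ∉ q := fun z hz hzq => hnew.2 z hzq hz
  have hSw : ∀ z ∈ S, z ≠ w := fun z hz => ne_of_mem_of_not_mem hz hnew.1
  obtain ⟨c', heq, hmem, hchain⟩ := FanColorable.exists_coloring (c := Function.update c w γ)
    (by simpa [hSw b hb] using hfan) (List.nodup_cons.2 ⟨hq b hb, hnodup.2⟩)
  have hw : c' w = γ := by simp [heq w hnodup.1]
  have hS : ∀ z ∈ S, c' z = c z := fun z hz => by simp [heq z (hq z hz), hSw z hz]
  simp only [Finset.mem_sdiff, Finset.mem_insert, Finset.mem_singleton, not_or] at hγ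
  obtain ⟨hγ, hγx, hγy, hγb⟩ := hγ
  refine ⟨c', ⟨((hc.isColoring.congr fun z hz => hS z (hH hz)).sup
    (isColoring_pathOf hchain)).sup (isColoring_starOf ?_), ?_⟩, hw⟩
  · rw [hw]
    rintro z (rfl | rfl | hz)
    · rwa [hS z hx, σ.ne_apply_comm]
    · rwa [hS z hy, σ.ne_apply_comm]
    · rcases List.mem_cons.1 hz with rfl | hz
      · rwa [hS z hb, σ.ne_apply_comm]
      · exact (hmem z hz).2
  · rintro z (hz | hz)
    · exact hS z hz ▸ hc.mem_list z hz
    · rcases List.mem_cons.1 hz with rfl | hz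
      · rwa [hw]
      · exact (hmem z hz).1

theorem IsListColoring.hasTwoListColorings_attachFan (hc : σ.IsListColoring H S L c)
    (hH : H.support ⊆ S) (hx : x ∈ S) (hy : y ∈ S) (hb : b ∈ S) (hnew : ∀ z ∈ w :: q, z ∉ S)
    (hnodup : (w :: q).Nodup) (hw : 5 ≤ (L w).card) (hq : ∀ z ∈ q, 3 ≤ (L z).card) :
    σ.HasTwoListColorings (attachFan H x y b w q) (S ∪ {z | z ∈ w :: q}) L w := by
  classical
  have hcard : 1 < (L w \ {σ x w (c x), σ y w (c y), σ b w (c b)}).card := by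
    have := Finset.le_card_sdiff {σ x w (c x), σ y w (c y), σ b w (c b)} (L w)
    have := Finset.card_le_three (a := σ x w (c x)) (b := σ y w (c y)) (c := σ b w (c b))
    lia
  obtain ⟨γ₁, hγ₁, γ₂, hγ₂, hne⟩ := Finset.one_lt_card.1 hcard
  obtain ⟨c₁, hc₁, rfl⟩ := hc.exists_attachFan hH hx hy hb hnew hnodup hγ₁
    (fanColorable_of_three_le_card hq _ _)
  obtain ⟨c₂, hc₂, rfl⟩ := hc.exists_attachFan hH hx hy hb hnew hnodup hγ₂
    (fanColorable_of_three_le_card hq _ _)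
  exact ⟨c₁, c₂, hc₁, hc₂, hne⟩

theorem HasTwoListColorings.exists_attachFan {z : V} {α : A} (h : σ.HasTwoListColorings H S L y)
    (hH : H.support ⊆ S) (hx : x ∈ S) (hy : y ∈ S) (hb : b ∈ S)
    (hnew : ∀ v ∈ w :: (q ++ [z]), v ∉ S) (hnodup : (w :: (q ++ [z])).Nodup) (hLx : L x = {α})
    (hw : 5 ≤ (L w).card) (hq : ∀ v ∈ q, 3 ≤ (L v).card) (hz : 2 ≤ (L z).card) :
    ∃ c, σ.IsListColoring (attachFan H x y b w (q ++ [z])) (S ∪ {v | v ∈ w :: (q ++ [z])}) L c := by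
  classical
  obtain ⟨c, c', hc, hc', hne⟩ := h
  have apply_eq {c : V → A} (hc : σ.IsListColoring H S L c) : c x = α :=
    Finset.mem_singleton.1 (hLx ▸ hc.mem_list x hx)
  rcases exists_fanColorable (σ := σ) (b := b) (β := c b) (β' := c' b) hq hz hw
    ((σ y w).injective.ne hne) (σ x w α) (σ b w) with ⟨γ, hγ, hfan⟩ | ⟨γ, hγ, hfan⟩
  · obtain ⟨c, hc, -⟩ :=
      hc.exists_attachFan hH hx hy hb hnew hnodup (by rwa [apply_eq hc]) hfan
    exact ⟨c, hc⟩
  · obtain ⟨c, hc, -⟩ :=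
      hc'.exists_attachFan hH hx hy hb hnew hnodup (by rwa [apply_eq hc']) hfan
    exact ⟨c, hc⟩

theorem HasTwoListColorings.exists_attachFan_ne {z : V} (h : σ.HasTwoListColorings H S L y)
    (hH : H.support ⊆ S) (hx : x ∈ S) (hy : y ∈ S) (hb : b ∈ S)
    (hnew : ∀ v ∈ w :: (q ++ [z]), v ∉ S) (hnodup : (w :: (q ++ [z])).Nodup) {α : A}
    (hLx : L x = {α}) (hw : 5 ≤ (L w).card) (hq : ∀ v ∈ q ++ [z], 3 ≤ (L v).card) :
    ∃ c, σ.IsListColoring (attachFan H x y b w (q ++ [z])) (S ∪ {v | v ∈ w :: (q ++ [z])}) L c ∧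
      c z ≠ σ x z (c x) := by
  classical
  set L' := Function.update L z ((L z).erase (σ x z α))
  have hL'z : L' z = (L z).erase (σ x z α) := Function.update_self ..
  have hL'_of_ne {v : V} (hv : v ≠ z) : L' v = L v := Function.update_of_ne hv ..
  have hS {v : V} (hv : v ∈ S) : v ≠ z := fun hvz => hnew z (by simp) (hvz ▸ hv)
  have hL'L (v : V) : L' v ⊆ L v := by
    by_cases hv : v = z
    · rw [hv, hL'z]
      exact Finset.erase_subset ..
    · rw [hL'_of_ne hv]
  have h' : σ.HasTwoListColorings H S L' y := h.mono_list fun v hv => (hL'_of_ne (hS hv)).ge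
  have hz : 2 ≤ (L' z).card := by
    have := hq z (by simp)
    have := Finset.pred_card_le_card_erase (s := L z) (a := σ x z α)
    rw [hL'z]
    lia
  have hw' : 5 ≤ (L' w).card := by rwa [hL'_of_ne (by grind)]
  have hq' : ∀ v ∈ q, 3 ≤ (L' v).card := fun v hv => by
    rw [hL'_of_ne (by grind)]
    exact hq v (List.mem_append_left _ hv)
  obtain ⟨c, hc⟩ := h'.exists_attachFan hH hx hy hb hnew hnodup ((hL'_of_ne (hS hx)).trans hLx)
    hw' hq' hz
  have hcx : c x = α := by simpa [hL'_of_ne (hS hx), hLx] using hc.mem_list x (.inl hx)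
  have hcz : c z ∈ L' z := hc.mem_list z (.inr (by simp))
  rw [hL'z] at hcz
  exact ⟨c, hc.mono_list fun v _ => hL'L v, hcx ▸ Finset.ne_of_mem_erase hcz⟩

end Correspondence

section Path

variable {V : Type*} {l : List V} {a b x y : V}

theorem Consecutive.mem (h : Consecutive l x y) : x ∈ l ∧ y ∈ l :=
  ⟨h.subset (by simp), h.subset (by simp)⟩

theorem consecutive_cons_cons :
    Consecutive (a :: b :: l) x y ↔ (x = a ∧ y = b) ∨ Consecutive (b :: l) x y := by
  rw [Consecutive, List.infix_cons_iff]
  simp [Consecutive]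

theorem pathOf_adj : (pathOf l).Adj x y ↔ x ≠ y ∧ (Consecutive l x y ∨ Consecutive l y x) :=
  SimpleGraph.fromRel_adj _ _ _

theorem support_pathOf_subset (l : List V) : (pathOf l).support ⊆ {x | x ∈ l} :=
  fun _ ⟨_, hxy⟩ => (pathOf_adj.1 hxy).2.elim (fun h => h.mem.1) fun h => h.mem.2

theorem pathOf_cons_cons : pathOf (a :: b :: l) = SimpleGraph.edge a b ⊔ pathOf (b :: l) := by
  ext x y
  simp only [SimpleGraph.sup_adj, pathOf_adj, consecutive_cons_cons, SimpleGraph.edge_adj]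
  tauto

theorem pathOf_reverse (l : List V) : pathOf l.reverse = pathOf l := by
  have h (x y : V) : Consecutive l.reverse x y ↔ Consecutive l y x := by
    simp [Consecutive, ← List.reverse_infix (l₂ := l)]
  ext x y
  rw [pathOf_adj, pathOf_adj, h, h, or_comm]

theorem starOf_adj {w : V} {T : Set V} :
    (starOf w T).Adj x y ↔ x ≠ y ∧ ((x = w ∧ y ∈ T) ∨ (y = w ∧ x ∈ T)) :=
  SimpleGraph.fromRel_adj _ _ _

theorem getLast?_eq_of_append_eq_cons {p s t : List V} {d : V} (hd : p ++ [b] = d :: s) :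
    (d :: (s ++ t)).getLast? = (b :: t).getLast? := by
  rw [← List.cons_append, ← hd, List.append_assoc, List.singleton_append,
    List.getLast?_append_cons]

end Path

theorem not_preconnected_induce_of_neighborSet_subset {V : Type*} {H : SimpleGraph V} {S T : Set V}
    {w v : V} (hw : w ∈ S \ T) (hv : v ∈ S \ T) (hne : w ≠ v) (hT : H.neighborSet w ⊆ T) :
    ¬ (H.induce (S \ T)).Preconnected := fun hcon => by
  have : Nontrivial ↥(S \ T) := ⟨⟨w, hw⟩, ⟨v, hv⟩, by simpa using hne⟩
  obtain ⟨z, hz⟩ := hcon.exists_adj_of_nontrivial ⟨w, hw⟩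
  exact z.2.2 (hT hz)

namespace PlaneGraph

variable {V : Type*} {G : PlaneGraph V} {l r : List V} {a b u w x y : V} {p : List V}

/-- The incidences that every drawing satisfies: the edges and faces are spanned by the vertices of
`G`, and the outer cycle is a list of distinct vertices of `G`. -/
structure IsWellFormed (G : PlaneGraph V) : Prop where
  outer_nodup : G.outer.Nodup
  outer_mem : ∀ x ∈ G.outer, x ∈ G.verts
  adj_mem : ∀ x y, G.graph.Adj x y → x ∈ G.verts
  face_mem : ∀ T ∈ G.faces, ∀ x ∈ T, x ∈ G.verts

theorem isWellFormed_wheel {h : V} {C : List V} (hnodup : (h :: C).Nodup) :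
    (wheel h C).IsWellFormed := by
  have hmem : ∀ x ∈ C ++ C.take 1, x ∈ C := fun x hx =>
    (List.mem_append.1 hx).elim id List.mem_of_mem_take
  refine ⟨(List.nodup_cons.1 hnodup).2, fun x hx => .inr hx, fun x y hxy => ?_, ?_⟩
  · rcases hxy with hxy | hxy
    · exact .inr (hmem x (support_pathOf_subset _ ⟨y, hxy⟩))
    · rcases (starOf_adj.1 hxy).2 with ⟨rfl, -⟩ | ⟨-, hx⟩
      · exact .inl rfl
      · exact .inr hx
  · rintro T ⟨x, y, hxy, rfl⟩ z (rfl | rfl | rfl)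
    · exact .inl rfl
    · exact .inr (hmem _ hxy.mem.1)
    · exact .inr (hmem _ hxy.mem.2)

theorem insertWheel_adj :
    (G.insertWheel l r a b u w p).graph.Adj x y ↔
      (G.graph.Adj x y ∧ s(x, y) ≠ s(a, b)) ∨
      (x ≠ y ∧ (Consecutive (a :: p ++ [b]) x y ∨ Consecutive (a :: p ++ [b]) y x)) ∨
      (x ≠ y ∧ ((x = w ∧ (y = u ∨ y ∈ a :: p ++ [b])) ∨
        (y = w ∧ (x = u ∨ x ∈ a :: p ++ [b])))) := by
  simp only [insertWheel, SimpleGraph.sup_adj, SimpleGraph.deleteEdges_adj, Set.mem_singleton_iff,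
    pathOf_adj, starOf_adj, Set.mem_ofPred_eq, or_assoc, ne_eq]

/-- The requirements under which `G.insertWheel l r a b u w p` makes sense: `ab` is an edge of the
outer cycle, `u` is an old vertex, and the hub `w` and the entries of `p` are distinct new
vertices. -/
structure CanInsert (G : PlaneGraph V) (l r : List V) (a b u w : V) (p : List V) : Prop where
  isWellFormed : G.IsWellFormed
  outer_eq : G.outer = l ++ [a, b] ++ r
  mem : u ∈ G.verts
  notMem : ∀ x ∈ w :: p, x ∉ G.verts
  nodup : (w :: p).Nodup

namespace CanInsert

variable (h : G.CanInsert l r a b u w p)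
include h

theorem left_mem : a ∈ G.verts := h.isWellFormed.outer_mem a (by simp [h.outer_eq])

theorem right_mem : b ∈ G.verts := h.isWellFormed.outer_mem b (by simp [h.outer_eq])

theorem ne_hub (hx : x ∈ G.verts) : x ≠ w := fun hxw => h.notMem w (by simp) (hxw ▸ hx)

theorem notMem_path (hx : x ∈ G.verts) : x ∉ p := fun hxp => h.notMem x (by simp [hxp]) hx

theorem hub_notMem_path : w ∉ a :: p ++ [b] := by
  have ha := h.ne_hub h.left_mem
  have hb := h.ne_hub h.right_mem
  simpa [ha.symm, hb.symm] using (List.nodup_cons.1 h.nodup).1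

theorem mem_verts_of_mem_path (hx : x ∈ a :: p ++ [b]) :
    x ∈ (G.insertWheel l r a b u w p).verts := by
  simp only [List.cons_append, List.mem_cons, List.mem_append, List.not_mem_nil, or_false] at hx
  rcases hx with rfl | hx | rfl
  · exact .inl h.left_mem
  · exact .inr (.inr hx)
  · exact .inl h.right_mem

theorem adj_hub_iff :
    (G.insertWheel l r a b u w p).graph.Adj w x ↔ x = u ∨ x ∈ a :: p ++ [b] := by
  rw [insertWheel_adj]
  have hw := h.hub_notMem_path
  have hu := h.ne_hub h.mem
  constructor
  · rintro (⟨hwx, -⟩ | ⟨-, hwx | hxw⟩ | ⟨-, ⟨-, hx⟩ | ⟨-, hwu | hw'⟩⟩)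
    · exact absurd (h.isWellFormed.adj_mem _ _ hwx) (h.notMem w (by simp))
    · exact absurd hwx.mem.1 hw
    · exact absurd hxw.mem.2 hw
    · exact hx
    · exact absurd hwu.symm hu
    · exact absurd hw' hw
  · intro hx
    refine .inr (.inr ⟨?_, .inl ⟨rfl, hx⟩⟩)
    rintro rfl
    exact hx.elim hu.symm hw

theorem outer_nodup : (G.insertWheel l r a b u w p).outer.Nodup := by
  have hnodup : (p ++ G.outer).Nodup := List.nodup_append'.2
    ⟨(List.nodup_cons.1 h.nodup).2, h.isWellFormed.outer_nodup, fun x hxp hx =>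
      h.notMem_path (h.isWellFormed.outer_mem x hx) hxp⟩
  have hperm : (G.insertWheel l r a b u w p).outer.Perm (p ++ G.outer) := by
    classical
    rw [List.perm_iff_count]
    intro x
    simp only [insertWheel, h.outer_eq, List.count_append, List.count_cons, List.count_nil]
    lia
  exact hperm.nodup_iff.2 hnodup

theorem mem_outer_iff : x ∈ (G.insertWheel l r a b u w p).outer ↔ x ∈ G.outer ∨ x ∈ p := by
  simp only [insertWheel, h.outer_eq, List.mem_append, List.mem_cons, List.not_mem_nil, or_false]
  tauto

theorem isWellFormed_insertWheel : (G.insertWheel l r a b u w p).IsWellFormed := by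
  have hpath := fun x => h.mem_verts_of_mem_path (x := x)
  have hw : w ∈ (G.insertWheel l r a b u w p).verts := .inr (.inl rfl)
  refine ⟨h.outer_nodup, fun x hx => ?_, fun x y hxy => ?_, ?_⟩
  · exact (h.mem_outer_iff.1 hx).elim (fun hx => .inl (h.isWellFormed.outer_mem x hx))
      fun hx => .inr (.inr hx)
  · rcases insertWheel_adj.1 hxy with
      ⟨hxy, -⟩ | ⟨-, hxy | hyx⟩ | ⟨-, ⟨rfl, -⟩ | ⟨-, rfl | hx⟩⟩
    · exact .inl (h.isWellFormed.adj_mem _ _ hxy)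
    · exact hpath _ hxy.mem.1
    · exact hpath _ hyx.mem.2
    · exact hw
    · exact .inl h.mem
    · exact hpath _ hx
  · rintro T (⟨⟨hT, -⟩ | (rfl | rfl)⟩ | ⟨x, y, hxy, rfl⟩) z hz
    · exact .inl (h.isWellFormed.face_mem T hT z hz)
    · rcases hz with rfl | rfl | rfl
      exacts [hw, .inl h.mem, .inl h.left_mem]
    · rcases hz with rfl | rfl | rfl
      exacts [hw, .inl h.mem, .inl h.right_mem]
    · rcases hz with rfl | rfl | rfl
      exacts [hw, hpath _ hxy.mem.1, hpath _ hxy.mem.2]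

theorem hub_mem_inner : w ∈ (G.insertWheel l r a b u w p).inner := by
  refine ⟨.inr (.inl rfl), fun hw => ?_⟩
  rcases h.mem_outer_iff.1 hw with hw | hw
  · exact h.ne_hub (h.isWellFormed.outer_mem w hw) rfl
  · exact (List.nodup_cons.1 h.nodup).1 hw

theorem inner_subset : G.inner ⊆ (G.insertWheel l r a b u w p).inner := fun _ hx =>
  ⟨.inl hx.1, fun hx' => (h.mem_outer_iff.1 hx').elim hx.2 (h.notMem_path hx.1)⟩

theorem adj_of_adj_insertWheel (hx : x ∈ G.inner) (hy : y ∈ G.verts)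
    (hxy : (G.insertWheel l r a b u w p).graph.Adj x y) : G.graph.Adj x y := by
  have hpath : x ∉ a :: p ++ [b] := by
    have hxo := hx.2
    simp only [h.outer_eq, List.mem_append, List.mem_cons, List.not_mem_nil, or_false,
      not_or] at hxo
    simp [hxo, h.notMem_path hx.1]
  rcases insertWheel_adj.1 hxy with ⟨hxy, -⟩ | ⟨-, hxy | hyx⟩ | ⟨-, ⟨hxw, -⟩ | ⟨hyw, -⟩⟩
  · exact hxy
  · exact absurd hxy.mem.1 hpath
  · exact absurd hyx.mem.2 hpath
  · exact absurd hxw (h.ne_hub hx.1)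
  · exact absurd hyw (h.ne_hub hy)

end CanInsert

theorem IsMultiWheel.isWellFormed (hG : G.IsMultiWheel) : G.IsWellFormed := by
  induction hG with
  | wheel h C _ hnodup => exact isWellFormed_wheel hnodup
  | insert G l r a b u w p _ houter _ hu _ _ hnew hnodup ih =>
    exact CanInsert.isWellFormed_insertWheel ⟨ih, houter, hu, hnew, hnodup⟩

theorem CanInsert.eq_of_adj_hub (h : G.CanInsert l r a b u w p) (hl : l ≠ []) (hu : u ∉ G.outer)
    {v₁ v₂ : V} {t : List V} (hout : (G.insertWheel l r a b u w p).outer = v₁ :: v₂ :: t)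
    (hadj : (G.insertWheel l r a b u w p).graph.Adj w v₂) : l = [v₁] ∧ a = v₂ := by
  have hpath : v₂ ∈ a :: p ++ [b] := by
    refine (h.adj_hub_iff.1 hadj).resolve_left ?_
    rintro rfl
    exact (h.mem_outer_iff.1 (hout ▸ by simp)).elim hu (h.notMem_path h.mem)
  match l, hl with
  | [x], _ =>
    simp only [insertWheel, List.cons_append, List.nil_append, List.cons.injEq] at hout
    exact ⟨by rw [hout.1], hout.2.1⟩
  | x :: y :: l, _ =>
    have hnodup := h.outer_nodup
    simp only [insertWheel, List.cons_append, List.cons.injEq] at hout hpath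
    rw [← hout.2.1] at hpath
    simp only [insertWheel, List.cons_append] at hnodup
    grind

theorem eq_of_mem_fanFaces {d : V} {s : List V} {T : Set V} (hT : T ∈ fanFaces w (a :: d :: s))
    (haT : a ∈ T) (ha : a ∉ w :: d :: s) : T = {w, a, d} := by
  obtain ⟨x, y, hxy, rfl⟩ := hT
  rw [List.mem_cons, not_or] at ha
  rcases consecutive_cons_cons.1 hxy with ⟨rfl, rfl⟩ | hxy
  · rfl
  · rcases haT with rfl | rfl | rfl
    exacts [absurd rfl ha.1, absurd hxy.mem.1 ha.2, absurd hxy.mem.2 ha.2]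

/-- The multi-wheels with outer cycle `v₁ v₂ b …` that arise from a wheel by repeatedly inserting a
wheel into the triangle formed by `v₂`, the third vertex of the outer cycle and the hub of the
previous wheel.  `IsNested v₁ v₂ G w b t` says that `G` is such a graph, with outer cycle
`v₁ :: v₂ :: b :: t` and newest hub `w`. -/
inductive IsNested (v₁ v₂ : V) : PlaneGraph V → V → V → List V → Prop
  | wheel {h b : V} {t : List V} (hnodup : (h :: v₁ :: v₂ :: b :: t).Nodup) :
      IsNested v₁ v₂ (PlaneGraph.wheel h (v₁ :: v₂ :: b :: t)) h b t
  | insert {G : PlaneGraph V} {u b w d : V} {t p s : List V} (hG : IsNested v₁ v₂ G u b t)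
      (hnew : ∀ x ∈ w :: p, x ∉ G.verts) (hnodup : (w :: p).Nodup) (hd : p ++ [b] = d :: s) :
      IsNested v₁ v₂ (G.insertWheel [v₁] t v₂ b u w p) w d (s ++ t)

namespace IsNested

variable {v₁ v₂ d : V} {t s : List V}

theorem outer_eq (h : IsNested v₁ v₂ G w b t) : G.outer = v₁ :: v₂ :: b :: t := by
  cases h with
  | wheel => rfl
  | insert hG hnew hnodup hd => simp [insertWheel, hd]

theorem hub_mem (h : IsNested v₁ v₂ G w b t) : w ∈ G.verts := by
  cases h with
  | wheel => exact .inl rfl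
  | insert => exact .inr (.inl rfl)

theorem isWellFormed (h : IsNested v₁ v₂ G w b t) : G.IsWellFormed := by
  induction h with
  | wheel hnodup => exact isWellFormed_wheel hnodup
  | insert hG hnew hnodup _ ih =>
    exact CanInsert.isWellFormed_insertWheel
      ⟨ih, by simp [hG.outer_eq], hG.hub_mem, hnew, hnodup⟩

theorem canInsert (h : IsNested v₁ v₂ G u b t) (hnew : ∀ x ∈ w :: p, x ∉ G.verts)
    (hnodup : (w :: p).Nodup) : G.CanInsert [v₁] t v₂ b u w p :=
  ⟨h.isWellFormed, by simp [h.outer_eq], h.hub_mem, hnew, hnodup⟩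

theorem hub_mem_inner (h : IsNested v₁ v₂ G w b t) : w ∈ G.inner := by
  cases h with
  | wheel hnodup => exact ⟨.inl rfl, (List.nodup_cons.1 hnodup).1⟩
  | insert hG hnew hnodup hd => exact (hG.canInsert hnew hnodup).hub_mem_inner

theorem outer_nodup (h : IsNested v₁ v₂ G w b t) : (v₁ :: v₂ :: b :: t).Nodup :=
  h.outer_eq ▸ h.isWellFormed.outer_nodup

theorem mem_verts (h : IsNested v₁ v₂ G w b t) (hx : x ∈ v₁ :: v₂ :: b :: t) : x ∈ G.verts :=
  h.isWellFormed.outer_mem x (h.outer_eq ▸ hx)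

theorem hub_notMem (h : IsNested v₁ v₂ G w b t) : w ∉ v₁ :: v₂ :: b :: t :=
  h.outer_eq ▸ h.hub_mem_inner.2

theorem adj_hub (h : IsNested v₁ v₂ G w b t) : G.graph.Adj w v₂ ∧ G.graph.Adj w b := by
  have hne := h.hub_notMem
  simp only [List.mem_cons, not_or] at hne
  cases h with
  | wheel =>
    exact ⟨.inr (starOf_adj.2 ⟨hne.2.1, .inl ⟨rfl, by simp⟩⟩),
      .inr (starOf_adj.2 ⟨hne.2.2.1, .inl ⟨rfl, by simp⟩⟩)⟩
  | insert hG hnew hnodup hd =>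
    have h := hG.canInsert hnew hnodup
    exact ⟨h.adj_hub_iff.2 (by simp), h.adj_hub_iff.2 (by simp [hd])⟩

theorem eq_of_mem_faces (h : IsNested v₁ v₂ G w b t) {T : Set V} (hT : T ∈ G.faces)
    (h₂ : v₂ ∈ T) (hb : b ∈ T) : T = {w, v₂, b} := by
  have hhub := h.hub_notMem
  have houter := h.outer_nodup
  induction h with
  | @wheel h b t hnodup =>
    obtain ⟨x, y, hxy, rfl⟩ := hT
    rcases consecutive_cons_cons.1 hxy with ⟨rfl, rfl⟩ | hxy
    · grind
    · have hv₂ : v₂ ∉ h :: b :: (t ++ [v₁]) := by grind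
      exact eq_of_mem_fanFaces (s := t ++ [v₁]) ⟨x, y, hxy, rfl⟩ h₂ hv₂
  | @insert G u b w d t p s hG hnew hnodup hd ih =>
    have hI := hG.canInsert hnew hnodup
    have hv₂ : v₂ ∉ w :: d :: s := by grind
    have hu₂ := hG.adj_hub.1.ne
    have hd' : d ∈ G.verts → d = b := fun hdG => by
      have := hI.notMem_path hdG
      grind
    rcases hT with ⟨⟨hT, hT'⟩ | (rfl | rfl)⟩ | hT
    · obtain rfl := hd' (hI.isWellFormed.face_mem T hT d hb)
      refine absurd (ih hT hb hG.hub_notMem hG.outer_nodup) fun hT₀ => hT' ?_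
      rw [Set.mem_singleton_iff, hT₀, Set.insert_comm, Set.pair_comm]
    · have := hG.adj_hub.2.ne
      have := hG.hub_mem
      grind
    · grind
    · rw [List.cons_append, hd] at hT
      exact eq_of_mem_fanFaces hT h₂ hv₂

theorem eq_hub_of_mem_faces (h : IsNested v₁ v₂ G w b t) (hface : {v₂, b, u} ∈ G.faces)
    (hu : u ∉ G.outer) : u = w := by
  have hT := h.eq_of_mem_faces hface (by simp) (by simp)
  have hu' : u ∈ ({w, v₂, b} : Set V) := hT ▸ by simp
  rw [h.outer_eq] at hu
  grind

end IsNested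

theorem IsMultiWheel.exists_isNested {v₁ v₂ : V} {t : List V} (hG : G.IsMultiWheel)
    (hout : G.outer = v₁ :: v₂ :: b :: t) (hv₂ : ∀ x ∈ G.inner, G.graph.Adj x v₂) :
    ∃ w, IsNested v₁ v₂ G w b t := by
  induction hG generalizing b t with
  | wheel h C hlen hnodup =>
    obtain rfl : C = _ := hout
    exact ⟨h, .wheel hnodup⟩
  | insert G l r a b' u w p hG houter hl hu hu' hface hnew hnodup ih =>
    have hI : G.CanInsert l r a b' u w p := ⟨hG.isWellFormed, houter, hu, hnew, hnodup⟩
    obtain ⟨rfl, rfl⟩ := hI.eq_of_adj_hub hl hu' hout (hv₂ w hI.hub_mem_inner)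
    obtain ⟨w₀, hw₀⟩ := ih (t := r) (by simpa using houter) fun x hx =>
      hI.adj_of_adj_insertWheel hx hI.left_mem (hv₂ x (hI.inner_subset hx))
    obtain rfl := hw₀.eq_hub_of_mem_faces hface hu'
    obtain ⟨d, s, hd⟩ : ∃ d s, p ++ [b'] = d :: s := List.exists_cons_of_ne_nil (by simp)
    have ht : b :: t = d :: (s ++ r) := by simpa [insertWheel, hd] using hout.symm
    obtain ⟨rfl, rfl⟩ := List.cons.inj ht
    exact ⟨w, .insert hw₀ hnew hnodup hd⟩

section DeleteEdge

variable {v₁ v₂ vk d h : V} {s t q : List V}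

theorem deleteEdges_sup_pathOf_le (H K : SimpleGraph V) (hq : q.reverse = d :: s) :
    (H ⊔ pathOf (a :: q.reverse) ⊔ K).deleteEdges {s(a, d)} ≤ H ⊔ pathOf q ⊔ K := by
  rw [SimpleGraph.deleteEdges, ← SimpleGraph.edge, sdiff_le_iff, ← pathOf_reverse q, hq,
    pathOf_cons_cons]
  exact le_of_eq (by ac_rfl)

theorem insertWheel_deleteEdges_le (hd : p ++ [b] = d :: s) :
    (G.insertWheel l r a b u w p).graph.deleteEdges {s(a, d)} ≤
      attachFan (G.graph.deleteEdges {s(a, b)}) a u b w p.reverse := by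
  have hq : (b :: p.reverse).reverse = p ++ [b] := by simp
  have hset : {x | x = u ∨ x ∈ a :: p ++ [b]} = {z | z = a ∨ z = u ∨ z ∈ b :: p.reverse} := by
    ext x
    simp [or_left_comm, or_comm]
  have hle := deleteEdges_sup_pathOf_le (a := a) (G.graph.deleteEdges {s(a, b)})
    (starOf w {x | x = u ∨ x ∈ a :: p ++ [b]}) (hq.trans hd)
  rw [hq, hset] at hle
  rw [insertWheel, attachFan, hset]
  exact hle

theorem wheel_deleteEdges_le (hs : b :: t = s ++ [vk]) :
    (wheel h (v₁ :: v₂ :: b :: t)).graph.deleteEdges {s(v₂, b)} ≤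
      attachFan (pathOf [vk, v₁, v₂]) v₁ v₂ vk h s.reverse := by
  have ht : pathOf (b :: t ++ [v₁]) = pathOf (v₁ :: vk :: s.reverse) := by
    rw [← pathOf_reverse, hs]
    simp
  have hset : {x | x ∈ v₁ :: v₂ :: b :: t} = {z | z = v₁ ∨ z = v₂ ∨ z ∈ vk :: s.reverse} := by
    ext x
    rw [hs]
    simp [or_comm]
  have hcycle : v₁ :: v₂ :: b :: t ++ List.take 1 (v₁ :: v₂ :: b :: t) =
    v₁ :: v₂ :: b :: (t ++ [v₁]) := rfl
  rw [wheel, attachFan, hset, hcycle, SimpleGraph.deleteEdges, ← SimpleGraph.edge, sdiff_le_iff,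
    pathOf_cons_cons, pathOf_cons_cons, ← List.cons_append, ht, pathOf_cons_cons, pathOf_cons_cons,
    pathOf_cons_cons, SimpleGraph.edge_comm vk v₁]
  dsimp only
  exact le_sup_left.trans_eq (b := _ ⊔ pathOf [v₂]) (by ac_rfl)

end DeleteEdge

/-- The data of `(ℤ₅, 3)`-extendability for a correspondence `σ`: the lists `L` consist of the
precolor `c₀ x` if `x` is `v₁`, `v₂` or `v_k`, of at least three colors at the other vertices of the
outer cycle, and of at least five colors at the inner vertices. -/
structure IsThreeAssignment {A : Type*} (G : PlaneGraph V) (σ : Correspondence V A) (v₁ v₂ vk : V)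
    (c₀ : V → A) (L : V → Finset A) : Prop where
  list_eq : ∀ x ∈ [v₁, v₂, vk], L x = {c₀ x}
  precolor : ∀ x ∈ [v₂, vk], G.graph.Adj v₁ x → c₀ x ≠ σ v₁ x (c₀ v₁)
  three_le : ∀ x ∈ G.outer, x ∉ [v₁, v₂, vk] → 3 ≤ (L x).card
  five_le : ∀ x ∈ G.inner, 5 ≤ (L x).card

variable {A : Type*} {σ : Correspondence V A} {v₁ v₂ vk : V} {c₀ : V → A} {L : V → Finset A}
  {t : List V}

theorem IsThreeAssignment.of_insertWheel (h : G.CanInsert l r a b u w p) (ha : v₁ ≠ a) (hb : v₁ ≠ b)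
    (hL : (G.insertWheel l r a b u w p).IsThreeAssignment σ v₁ v₂ vk c₀ L) :
    G.IsThreeAssignment σ v₁ v₂ vk c₀ L where
  list_eq := hL.list_eq
  precolor x hx hadj := hL.precolor x hx (insertWheel_adj.2 (.inl ⟨hadj, by simp [ha, hb]⟩))
  three_le x hx := hL.three_le x (h.mem_outer_iff.2 (.inl hx))
  five_le x hx := hL.five_le x (h.inner_subset hx)

theorem IsWellFormed.support_deleteEdges_subset (h : G.IsWellFormed) (E : Set (Sym2 V)) :
    (G.graph.deleteEdges E).support ⊆ G.verts := fun x ⟨y, hxy⟩ =>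
  h.adj_mem x y (SimpleGraph.deleteEdges_le E hxy)

theorem IsThreeAssignment.isListColoring_pathOf
    (hL : G.IsThreeAssignment σ v₁ v₂ vk c₀ L) (h₂ : G.graph.Adj v₁ v₂) (hk : G.graph.Adj v₁ vk) :
    σ.IsListColoring (pathOf [vk, v₁, v₂]) {x | x ∈ [v₁, v₂, vk]} L c₀ where
  isColoring := Correspondence.isColoring_pathOf (by
    simpa using ⟨σ.ne_apply_comm.1 (hL.precolor vk (by simp) hk), hL.precolor v₂ (by simp) h₂⟩)
  mem_list x hx := by simp [hL.list_eq x hx]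

theorem wheel_adj_of_consecutive {h : V} {C : List V} (hne : x ≠ y)
    (hxy : Consecutive (C ++ C.take 1) x y) : (wheel h C).graph.Adj x y :=
  .inl (pathOf_adj.2 ⟨hne, .inl hxy⟩)

theorem IsThreeAssignment.hasTwoListColorings_wheel {h b : V} {s : List V}
    (hnodup : (h :: v₁ :: v₂ :: b :: t).Nodup) (hs : b :: t = s ++ [vk])
    (hL : (wheel h (v₁ :: v₂ :: b :: t)).IsThreeAssignment σ v₁ v₂ vk c₀ L) :
    σ.HasTwoListColorings ((wheel h (v₁ :: v₂ :: b :: t)).graph.deleteEdges {s(v₂, b)})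
      (wheel h (v₁ :: v₂ :: b :: t)).verts L h := by
  have hle := wheel_deleteEdges_le (v₁ := v₁) (v₂ := v₂) (h := h) hs
  have hverts : (wheel h (v₁ :: v₂ :: b :: t)).verts ⊆
      {x | x ∈ [v₁, v₂, vk]} ∪ {z | z ∈ h :: s.reverse} := by
    intro x hx
    simp only [wheel, hs] at hx
    grind
  refine .mono ?_ hle hverts
  rw [hs] at hnodup hL
  have h₂ : (wheel h (v₁ :: v₂ :: (s ++ [vk]))).graph.Adj v₁ v₂ :=
    wheel_adj_of_consecutive (by grind) ⟨[], s ++ [vk, v₁], by simp⟩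
  have hk : (wheel h (v₁ :: v₂ :: (s ++ [vk]))).graph.Adj vk v₁ :=
    wheel_adj_of_consecutive (by grind) ⟨v₁ :: v₂ :: s, [], by simp⟩
  have hsupp : (pathOf [vk, v₁, v₂]).support ⊆ {x | x ∈ [v₁, v₂, vk]} :=
    (support_pathOf_subset _).trans fun x hx => by
      simp only [Set.mem_ofPred_eq, List.mem_cons] at hx ⊢
      tauto
  have hnodup' : (h :: s).Nodup :=
    hnodup.sublist ((((List.sublist_append_left s [vk]).cons _).cons _).cons_cons h)
  exact (hL.isListColoring_pathOf h₂ hk.symm).hasTwoListColorings_attachFan hsupp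
    (by simp) (by simp) (by simp) (by grind) (by simpa using hnodup')
    (hL.five_le h ⟨.inl rfl, (List.nodup_cons.1 hnodup).1⟩)
    (fun z hz => hL.three_le z (by grind [wheel]) (by grind))

namespace IsNested

theorem getLast_mem (h : IsNested v₁ v₂ G w b t) (hk : (b :: t).getLast? = some vk) :
    vk ∈ G.verts :=
  h.mem_verts (.tail _ (.tail _ (List.mem_of_getLast? hk)))

theorem three_le_of_mem_path (h : IsNested v₁ v₂ G u b t) (hI : G.CanInsert [v₁] t v₂ b u w p)
    (hk : (b :: t).getLast? = some vk)
    (hL : (G.insertWheel [v₁] t v₂ b u w p).IsThreeAssignment σ v₁ v₂ vk c₀ L) (hx : x ∈ p) :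
    3 ≤ (L x).card := by
  refine hL.three_le x (hI.mem_outer_iff.2 (.inr hx)) ?_
  have hG : x ∉ G.verts := hI.notMem x (.tail _ hx)
  have h₁ := h.mem_verts (x := v₁) (by simp)
  have := h.getLast_mem hk
  have := hI.left_mem
  grind

theorem hasTwoListColorings (h : IsNested v₁ v₂ G w b t) (hk : (b :: t).getLast? = some vk)
    (hL : G.IsThreeAssignment σ v₁ v₂ vk c₀ L) :
    σ.HasTwoListColorings (G.graph.deleteEdges {s(v₂, b)}) G.verts L w := by
  induction h with
  | wheel hnodup =>
    obtain ⟨s, hs⟩ := List.getLast?_eq_some_iff.1 hk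
    exact hL.hasTwoListColorings_wheel hnodup hs
  | @insert G u b w d t p s hG hnew hnodup hd ih =>
    have hI := hG.canInsert hnew hnodup
    have hk' := (getLast?_eq_of_append_eq_cons hd).symm.trans hk
    have houter := hG.outer_nodup
    obtain ⟨c, -, hc, -, -⟩ := ih hk' (hL.of_insertWheel hI (by grind) (by grind))
    have hverts : (G.insertWheel [v₁] t v₂ b u w p).verts ⊆
        G.verts ∪ {z | z ∈ w :: p.reverse} := by
      simp [insertWheel]
    refine .mono ?_ (insertWheel_deleteEdges_le hd) hverts
    exact hc.hasTwoListColorings_attachFan (hG.isWellFormed.support_deleteEdges_subset _)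
      hI.left_mem hI.mem hI.right_mem (by simpa using hnew) (by simpa using hnodup)
      (hL.five_le w hI.hub_mem_inner) fun z hz =>
        hG.three_le_of_mem_path hI hk' hL (List.mem_reverse.1 hz)

theorem exists_isListColoring_insertWheel {d : V} (h : IsNested v₁ v₂ G u b t)
    (hnew : ∀ x ∈ w :: d :: p, x ∉ G.verts) (hnodup : (w :: d :: p).Nodup)
    (hk : (b :: t).getLast? = some vk)
    (hL : (G.insertWheel [v₁] t v₂ b u w (d :: p)).IsThreeAssignment σ v₁ v₂ vk c₀ L) :
    ∃ c, σ.IsListColoring (G.insertWheel [v₁] t v₂ b u w (d :: p)).graph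
      (G.insertWheel [v₁] t v₂ b u w (d :: p)).verts L c := by
  have hI := h.canInsert hnew hnodup
  have houter := h.outer_nodup
  have htwo := h.hasTwoListColorings hk (hL.of_insertWheel hI (by grind) (by grind))
  have hperm : (w :: (p.reverse ++ [d])).Perm (w :: d :: p) := by
    rw [← List.reverse_cons]
    exact (List.reverse_perm _).cons w
  have hpath : ∀ x ∈ p.reverse ++ [d], 3 ≤ (L x).card := fun x hx =>
    h.three_le_of_mem_path hI hk hL (by simpa [or_comm] using hx)
  obtain ⟨c, hc, hcd⟩ := htwo.exists_attachFan_ne (q := p.reverse) (z := d)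
    (h.isWellFormed.support_deleteEdges_subset _) hI.left_mem hI.mem hI.right_mem
    (fun x hx => hnew x (hperm.mem_iff.1 hx)) (hperm.nodup_iff.2 hnodup) (hL.list_eq v₂ (by simp))
    (hL.five_le w hI.hub_mem_inner) hpath
  rw [← List.reverse_cons] at hc
  have hverts : (G.insertWheel [v₁] t v₂ b u w (d :: p)).verts ⊆
      G.verts ∪ {v | v ∈ w :: (d :: p).reverse} := by
    simp [insertWheel, or_comm]
  have hc := hc.mono (insertWheel_deleteEdges_le (l := [v₁]) (r := t) (p := d :: p) rfl) hverts
  exact ⟨c, hc.isColoring.of_deleteEdges hcd, hc.mem_list⟩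

theorem hasSeparatingTriangle (h : IsNested v₁ v₂ G u b t) (hw : w ∉ G.verts) :
    (G.insertWheel [v₁] t v₂ b u w []).HasSeparatingTriangle := by
  have hI := h.canInsert (by simpa using hw) (List.nodup_singleton w)
  have houter := h.outer_nodup
  have hub := h.hub_notMem
  have hw₁ := hI.ne_hub (h.mem_verts (x := v₁) (by simp))
  have hwu := hI.ne_hub hI.mem
  have hw := hI.hub_notMem_path
  refine ⟨v₂, b, u, ?_, ?_, ?_, not_preconnected_induce_of_neighborSet_subset (w := w) (v := v₁)
    ⟨.inr (.inl rfl), by grind⟩ ⟨.inl (h.mem_verts (by simp)), by grind⟩ hw₁.symm ?_⟩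
  · exact insertWheel_adj.2 (.inr (.inl ⟨by grind, .inl List.infix_rfl⟩))
  · exact insertWheel_adj.2 (.inl ⟨h.adj_hub.2.symm, by grind⟩)
  · exact insertWheel_adj.2 (.inl ⟨h.adj_hub.1.symm, by grind⟩)
  · intro x hx
    have := hI.adj_hub_iff.1 hx
    grind

end IsNested

/-- Extendability in the sense of correspondence colorings with colors in `A`: a coloring exists for
every correspondence, every precoloring of the path `v_k v₁ v₂`, and all lists of at least three
colors at the other vertices of the outer cycle and at least five at the inner vertices. -/
def IsThreeCorrespondenceExtendable (G : PlaneGraph V) (A : Type*) (v₁ v₂ vk : V) : Prop :=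
  ∀ (σ : Correspondence V A) (c₀ : V → A) (L : V → Finset A),
    G.IsThreeAssignment σ v₁ v₂ vk c₀ L → ∃ c, σ.IsListColoring G.graph G.verts L c

theorem encard_inner_wheel_le (h : V) (C : List V) : (wheel h C).inner.encard ≤ 1 :=
  Set.encard_le_one_iff.2 fun _ _ hx hy =>
    (hx.1.resolve_right hx.2).trans (hy.1.resolve_right hy.2).symm

theorem IsNested.isThreeCorrespondenceExtendable (h : IsNested v₁ v₂ G w b t)
    (hsep : ¬ G.HasSeparatingTriangle) (hinner : 2 ≤ G.inner.encard)
    (hk : (b :: t).getLast? = some vk) : G.IsThreeCorrespondenceExtendable A v₁ v₂ vk := by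
  intro σ c₀ L hL
  cases h with
  | wheel =>
    have := hinner.trans (encard_inner_wheel_le _ _)
    norm_num at this
  | @insert G u b _ _ t p s hG hnew hnodup hd =>
    have hk := (getLast?_eq_of_append_eq_cons hd).symm.trans hk
    match p with
    | [] => exact absurd (hG.hasSeparatingTriangle (hnew w (by simp))) hsep
    | d :: p => exact hG.exists_isListColoring_insertWheel hnew hnodup hk hL

end PlaneGraph

theorem corollary1_general {V A : Type*} (G : PlaneGraph V) (hG : G.IsMultiWheel)
    (hsep : ¬ G.HasSeparatingTriangle) (hinner : 2 ≤ G.inner.encard)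
    (v₁ v₂ vk : V) (m : List V) (houter : G.outer = [v₁, v₂] ++ m ++ [vk])
    (hv₂ : ∀ u ∈ G.inner, G.graph.Adj u v₂) :
    G.IsThreeCorrespondenceExtendable A v₁ v₂ vk := by
  obtain ⟨b, t, hbt⟩ : ∃ b t, m ++ [vk] = b :: t := List.exists_cons_of_ne_nil (by simp)
  have hout : G.outer = v₁ :: v₂ :: b :: t := by rw [houter, ← hbt]; rfl
  obtain ⟨w, hw⟩ := hG.exists_isNested hout hv₂
  exact hw.isThreeCorrespondenceExtendable hsep hinner (hbt ▸ List.getLast?_concat)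

namespace EdgeOrientation

variable {V : Type*} {G : SimpleGraph V}

open Classical in
/-- The signed value of `φ` on the pair `x, y`: a coloring `c` violates the condition on the edge
`xy` if `c y - c x` is equal to it.  It is zero on pairs that are not joined by an edge. -/
noncomputable def shift (D : EdgeOrientation G) (φ : Sym2 V → ZMod 5) (x y : V) : ZMod 5 :=
  if D.dir x y then φ s(x, y) else if D.dir y x then -φ s(x, y) else 0

theorem shift_swap (D : EdgeOrientation G) (φ : Sym2 V → ZMod 5) (x y : V) :
    D.shift φ y x = -D.shift φ x y := by
  have h := D.asymm x y
  unfold shift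
  rw [Sym2.eq_swap]
  by_cases hxy : D.dir x y
  · simp [hxy, h hxy]
  · by_cases hyx : D.dir y x <;> simp [hxy, hyx]

/-- The correspondence whose colorings are the `(ℤ₅, φ)`-colorings. -/
noncomputable def correspondence (D : EdgeOrientation G) (φ : Sym2 V → ZMod 5) :
    Correspondence V (ZMod 5) where
  perm x y := Equiv.addRight (D.shift φ x y)
  perm_symm x y := by rw [Equiv.addRight_symm, ← shift_swap]

theorem correspondence_apply (D : EdgeOrientation G) (φ : Sym2 V → ZMod 5) {x y : V}
    (hxy : G.Adj x y) (α : ZMod 5) : D.correspondence φ x y α = tau D φ x α y := by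
  change α + D.shift φ x y = _
  unfold tau shift
  by_cases h : D.dir x y
  · simp [h]
  · simp [h, (D.dir_or_dir x y hxy).resolve_left h, sub_eq_add_neg]

theorem isGroupColoring_of_isColoring {D : EdgeOrientation G} {φ : Sym2 V → ZMod 5}
    {c : V → ZMod 5} (hc : (D.correspondence φ).IsColoring G c) : IsGroupColoring D φ c := by
  intro x y hxy h
  have hadj := D.adj_of_dir x y hxy
  apply hc hadj
  rw [D.correspondence_apply φ hadj, tau, if_pos hxy, ← h]
  ring

end EdgeOrientation

theorem PlaneGraph.IsThreeCorrespondenceExtendable.isThreeExtendable {V : Type*} {G : PlaneGraph V}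
    {v₁ v₂ vk : V} (h : G.IsThreeCorrespondenceExtendable (ZMod 5) v₁ v₂ vk)
    (hG : ∀ x ∈ G.outer, x ∈ G.verts) (hverts : ∀ x ∈ [v₁, v₂, vk], x ∈ G.outer)
    (D : EdgeOrientation G.graph) (φ : Sym2 V → ZMod 5) : G.IsThreeExtendable D φ v₁ v₂ vk := by
  classical
  intro c₀ F hk h₂ hF hF_empty
  have hcard (x : V) : ((F x)ᶜ).card = 5 - (F x).card := by
    rw [Finset.card_compl, ZMod.card]
  let L : V → Finset (ZMod 5) := fun x => if x ∈ [v₁, v₂, vk] then {c₀ x} else (F x)ᶜ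
  have hLp {x : V} (hx : x ∈ [v₁, v₂, vk]) : L x = {c₀ x} := if_pos hx
  have hLF {x : V} (hx : x ∉ [v₁, v₂, vk]) : L x = (F x)ᶜ := if_neg hx
  obtain ⟨c, hc⟩ := h (D.correspondence φ) c₀ L {
    list_eq := fun x hx => hLp hx
    precolor := fun x hx hadj => by
      rw [D.correspondence_apply φ hadj]
      grind
    three_le := fun x hx hxp => by
      have := hF x hx (by grind) (by grind) (by grind)
      rw [hLF hxp, hcard]
      lia
    five_le := fun x hx => by
      rw [hLF fun hxp => hx.2 (hverts x hxp), hcard, hF_empty x fun hx' => hx.2 hx'.1]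
      simp }
  have hcp {x : V} (hx : x ∈ [v₁, v₂, vk]) : c x = c₀ x := by
    simpa [hLp hx] using hc.mem_list x (hG x (hverts x hx))
  refine ⟨c, hcp (by simp), hcp (by simp), hcp (by simp),
    EdgeOrientation.isGroupColoring_of_isColoring hc.isColoring, fun x hx h₁ h₂ hk => ?_⟩
  have hxp : x ∉ [v₁, v₂, vk] := by simp [h₁, h₂, hk]
  simpa [hLF hxp] using hc.mem_list x (hG x hx)

theorem corollary1 {V : Type*} (G : PlaneGraph V) (hG : G.IsMultiWheel)
    (hsep : ¬ G.HasSeparatingTriangle)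
    (hinner : 2 ≤ G.inner.encard)
    (v₁ v₂ vk : V) (m : List V) (houter : G.outer = [v₁, v₂] ++ m ++ [vk])
    (hv₂ : ∀ u ∈ G.inner, G.graph.Adj u v₂)
    (D : EdgeOrientation G.graph) (φ : Sym2 V → ZMod 5) :
    G.IsThreeExtendable D φ v₁ v₂ vk :=
  (corollary1_general G hG hsep hinner v₁ v₂ vk m houter hv₂).isThreeExtendable
    hG.isWellFormed.outer_mem (by simp [houter]) D φ
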